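/- Let $w_0:(0,\infty)\to\mathbb R$ be a (twice differentiable) solution of the radial Toda equation $$(w_0)_{xx}+\tfrac1x (w_0)_x = 2e^{-2w_0}-2e^{4w_0},$$ fix $x>0$, put $\omega=e^{2\pi i/3}$, $d_3=\mathrm{diag}(1,\omega,\omega^2)$, $w=\mathrm{diag}(w_0(x),0,-w_0(x))$, $w_x=\mathrm{diag}(w_0'(x),0,-w_0'(x))$, $$W=\begin{pmatrix}0&e^{-w_0(x)}&0\\0&0&e^{-w_0(x)}\\e^{2w_0(x)}&0&0\end{pmatrix},\qquad \Omega=\begin{pmatrix}1&1&1\\1&\omega&\omega^2\\1&\omega^2&\omega\end{pmatrix},\qquad P_0=e^{-w}\Omega,\qquad P_\infty=e^{w}\Omega^{-1},$$ and consider on the universal covering of $\mathbb C\setminus\{0\}$ the linear system $$\Psi_\zeta=\Bigl(-\tfrac1{\zeta^2}W-\tfrac x\zeta w_x-x^2W^T\Bigr)\Psi .\qquad(*)$$ It has unique formal solutions $\Psi_f^{(0)}=P_0(I+O(\zeta))e^{d_3/\zeta}$ at $\zeta=0$ and $\Psi_f^{(\infty)}=P_\infty(I+O(\zeta^{-1}))e^{-x^2\zeta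 d_3}$ at $\zeta=\infty$. For $n\in\frac13\mathbb Z$ let $\Omega_n^{(\infty)}$ be the sector $-\frac{2\pi}3+(n-1)\pi<\arg\zeta<\frac{2\pi}3+(n-1)\pi$ and let $\Omega_n^{(0)}$ be its image under $\zeta\mapsto\zeta^{-1}$. The canonical solution $\Psi_n^{(\infty)}$ (respectively $\Psi_n^{(0)}$) is the solution of $(*)$ which is asymptotic to $\Psi_f^{(\infty)}$ as $\zeta\to\infty$ in $\Omega_n^{(\infty)}$ (respectively to $\Psi_f^{(0)}$ as $\zeta\to0$ in $\Omega_n^{(0)}$), uniformly on closed subsectors, to all orders. The canonical solutions are invertible, and the matrices $$E_1=[\Psi_1^{(0)}]^{-1}\Psi_1^{(\infty)},\qquad Q_1=[\Psi_1^{(\infty)}]^{-1}\Psi_{4/3}^{(\infty)},\qquad S_1=[\Psi_1^{(\infty)}]^{-1}\Psi_2^{(\infty)}$$ are constant in $\zeta$. There are real numbers $A^{\mathbb R},s^{\mathbb R}$ and a complex number $B$ such that, with $a=\omega^2s^{\mathbb R}$, $$Q_1=\begin{pmatrix}1&a&0\\0&1&0\\0&0&1\end{pmatrix},\qquad S_1=\begin{pmatrix}1&a&0\\0&1&0\\a&-a\omega^2&1\end{pmatrix}$$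 (so $s^{\mathbb R}$ is the real Stokes parameter), the connection matrix is $$E_1=\begin{pmatrix}A^{\mathbb R}&B&\overline B\\ B&\omega s^{\mathbb R}A^{\mathbb R}-\omega^2s^{\mathbb R}B+\overline B&A^{\mathbb R}\\ \overline B&A^{\mathbb R}&\omega^2s^{\mathbb R}A^{\mathbb R}+B-\omega s^{\mathbb R}\overline B\end{pmatrix},$$ and $$(A^{\mathbb R})^2-\tfrac13A^{\mathbb R}=|B|^2,\qquad (1+s^{\mathbb R})A^{\mathbb R}+\omega B+\omega^2\overline B=\tfrac13 .$$ -/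

import Mathlib

open scoped Matrix ComplexConjugate

noncomputable section

namespace RadialToda

/-- Complex `3 × 3` matrices. -/
abbrev Mat3 : Type := Matrix (Fin 3) (Fin 3) ℂ

/-- Real-valued solutions on the half-line `x > 0` of the radial Toda equation
`w'' + w' / x = 2 exp (-2 w) - 2 exp (4 w)`. -/
def IsRadialTodaSolution (w : ℝ → ℝ) : Prop :=
  ∀ x : ℝ, 0 < x →
    DifferentiableAt ℝ w x ∧ DifferentiableAt ℝ (deriv w) x ∧
      deriv (deriv w) x + 1 / x * deriv w x
        = 2 * Real.exp (-2 * w x) - 2 * Real.exp (4 * w x)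

/-- The cube root of unity `exp (2 π i / 3)`. -/
def omega : ℂ := Complex.exp (2 * Real.pi * Complex.I / 3)

/-- `d₃ = diag (1, ω, ω²)`. -/
def d3 : Mat3 := Matrix.diagonal ![1, omega, omega ^ 2]

/-- The diagonal matrix `exp (c d₃)`. -/
def expD3 (c : ℂ) : Mat3 :=
  Matrix.diagonal ![Complex.exp c, Complex.exp (c * omega), Complex.exp (c * omega ^ 2)]

/-- The matrix `Ω` of third roots of unity. -/
def Omega : Mat3 :=
  !![1, 1, 1;
     1, omega, omega ^ 2;
     1, omega ^ 2, omega]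

/-- The matrix `W` at a point where the solution has the value `u`. -/
def W (u : ℝ) : Mat3 :=
  !![0, (Real.exp (-u) : ℂ), 0;
     0, 0, (Real.exp (-u) : ℂ);
     (Real.exp (2 * u) : ℂ), 0, 0]

/-- `diag (c, 0, -c)`; with `c = w₀'(x)` this is `w_x`. -/
def diagW (c : ℝ) : Mat3 := Matrix.diagonal ![(c : ℂ), 0, -(c : ℂ)]

/-- The coefficient matrix `A(ζ) = - W / ζ² - (x / ζ) w_x - x² Wᵀ` of the linear system
`Ψ_ζ = A(ζ) Ψ`. -/
def coeff (w : ℝ → ℝ) (x : ℝ) (ζ : ℂ) : Mat3 :=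
  -((1 / ζ ^ 2) • W (w x)) - ((x : ℂ) / ζ) • diagW (deriv w x) - ((x : ℂ) ^ 2) • (W (w x))ᵀ

/-- `P₀ = exp (-w) Ω`, where `exp (-w) = diag (exp (-w₀), 1, exp w₀)`. -/
def P0 (u : ℝ) : Mat3 :=
  Matrix.diagonal ![(Real.exp (-u) : ℂ), 1, (Real.exp u : ℂ)] * Omega

/-- `P_∞ = exp w Ω⁻¹`, which is the inverse transpose of `P₀`. -/
def Pinf (u : ℝ) : Mat3 :=
  Matrix.diagonal ![(Real.exp u : ℂ), 1, (Real.exp (-u) : ℂ)] * Omega⁻¹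

/-- Matrix solutions of `Ψ_ζ = A(ζ) Ψ` on the universal covering of `ℂ \ {0}`. The covering is
realised as `ℂ` with coordinate `z = log ζ`, so that `ζ = exp z`, `arg ζ = Im z`, `|ζ| = exp (Re z)`,
and the system reads `dΨ/dz = ζ A(ζ) Ψ`. -/
def IsSolution (w : ℝ → ℝ) (x : ℝ) (Ψ : ℂ → Mat3) : Prop :=
  ∀ (z : ℂ) (i j : Fin 3),
    HasDerivAt (fun y => Ψ y i j)
      (Complex.exp z * (coeff w x (Complex.exp z) * Ψ z) i j) z

/-- The series `P_∞ (I + ∑_{k ≥ 1} m k ζ^(-k)) exp (-x² ζ d₃)` is a formal solution of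
`Ψ_ζ = A(ζ) Ψ`: coefficients of `ζ^(-k)` are compared, with `m k = 0` for `k < 0` and
`m 0 = I`. -/
def IsFormalSolutionInf (w : ℝ → ℝ) (x : ℝ) (m : ℤ → Mat3) : Prop :=
  (∀ k < 0, m k = 0) ∧ m 0 = 1 ∧
    ∀ k : ℤ,
      -((k - 1 : ℤ) : ℂ) • (Pinf (w x) * m (k - 1)) - ((x : ℂ) ^ 2) • (Pinf (w x) * m k * d3)
        = -(W (w x) * (Pinf (w x) * m (k - 2)))
          - (x : ℂ) • (diagW (deriv w x) * (Pinf (w x) * m (k - 1)))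
          - ((x : ℂ) ^ 2) • ((W (w x))ᵀ * (Pinf (w x) * m k))

/-- The series `P₀ (I + ∑_{k ≥ 1} m k ζ^k) exp (d₃ / ζ)` is a formal solution of
`Ψ_ζ = A(ζ) Ψ`: coefficients of `ζ^(k-2)` are compared, with `m k = 0` for `k < 0` and
`m 0 = I`. -/
def IsFormalSolutionZero (w : ℝ → ℝ) (x : ℝ) (m : ℤ → Mat3) : Prop :=
  (∀ k < 0, m k = 0) ∧ m 0 = 1 ∧
    ∀ k : ℤ,
      ((k - 1 : ℤ) : ℂ) • (P0 (w x) * m (k - 1)) - P0 (w x) * m k * d3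
        = -(W (w x) * (P0 (w x) * m k))
          - (x : ℂ) • (diagW (deriv w x) * (P0 (w x) * m (k - 1)))
          - ((x : ℂ) ^ 2) • ((W (w x))ᵀ * (P0 (w x) * m (k - 2)))

/-- The range of `arg ζ` on the sector `Ω_n^(∞)`, namely
`-2π/3 + (n - 1) π < arg ζ < 2π/3 + (n - 1) π`, for `n ∈ (1/3) ℤ`. -/
def argRangeInf (n : ℚ) : Set ℝ :=
  Set.Ioo (-(2 * Real.pi / 3) + ((n : ℝ) - 1) * Real.pi)
    (2 * Real.pi / 3 + ((n : ℝ) - 1) * Real.pi)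

/-- The range of `arg ζ` on the sector `Ω_n^(0)`, the image of `Ω_n^(∞)` under `ζ ↦ ζ⁻¹`. -/
def argRangeZero (n : ℚ) : Set ℝ := {θ | -θ ∈ argRangeInf n}

/-- `Ψ` is the canonical solution `Ψ_n^(∞)`: it solves `Ψ_ζ = A(ζ) Ψ` and is asymptotic to the
formal solution as `ζ → ∞` in `Ω_n^(∞)`, i.e. for every `N`
`Ψ exp (x² ζ d₃) = P_∞ ∑_{k < N} m k ζ^(-k) + O(ζ^(-N))`, uniformly on closed subsectors. -/
def IsCanonicalInf (w : ℝ → ℝ) (x : ℝ) (n : ℚ) (Ψ : ℂ → Mat3) : Prop :=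
  IsSolution w x Ψ ∧ ∃ m : ℤ → Mat3, IsFormalSolutionInf w x m ∧
    ∀ (N : ℕ) (α β : ℝ), Set.Icc α β ⊆ argRangeInf n → ∀ i j : Fin 3,
      (fun z : ℂ => (Ψ z * expD3 ((x : ℂ) ^ 2 * Complex.exp z)
          - Pinf (w x) * ∑ k ∈ Finset.range N, (Complex.exp z ^ k)⁻¹ • m k) i j)
        =O[Filter.comap Complex.re Filter.atTop ⊓ Filter.principal {z | z.im ∈ Set.Icc α β}]
      (fun z : ℂ => (Complex.exp z ^ N)⁻¹)

/-- `Ψ` is the canonical solution `Ψ_n^(0)`: it solves `Ψ_ζ = A(ζ) Ψ` and is asymptotic to the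
formal solution as `ζ → 0` in `Ω_n^(0)`, i.e. for every `N`
`Ψ exp (-d₃ / ζ) = P₀ ∑_{k < N} m k ζ^k + O(ζ^N)`, uniformly on closed subsectors. -/
def IsCanonicalZero (w : ℝ → ℝ) (x : ℝ) (n : ℚ) (Ψ : ℂ → Mat3) : Prop :=
  IsSolution w x Ψ ∧ ∃ m : ℤ → Mat3, IsFormalSolutionZero w x m ∧
    ∀ (N : ℕ) (α β : ℝ), Set.Icc α β ⊆ argRangeZero n → ∀ i j : Fin 3,
      (fun z : ℂ => (Ψ z * expD3 (-(1 / Complex.exp z))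
          - P0 (w x) * ∑ k ∈ Finset.range N, (Complex.exp z ^ k) • m k) i j)
        =O[Filter.comap Complex.re Filter.atBot ⊓ Filter.principal {z | z.im ∈ Set.Icc α β}]
      (fun z : ℂ => Complex.exp z ^ N)

/-- `M` is the constant matrix `Φ⁻¹ Ψ` on the universal covering of `ℂ \ {0}`. -/
def IsTransitionMatrix (Φ Ψ : ℂ → Mat3) (M : Mat3) : Prop :=
  (∀ z, IsUnit (Φ z)) ∧ ∀ z, Ψ z = Φ z * M

end RadialToda

end

noncomputable section

namespace RadialToda

/-! ### The cube root of unity -/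

/-! The coefficient matrix has three symmetries of contragredient type: under ζ ↦ -ζ, under rotation
by π/3, and under ζ ↦ 1/(x²ζ). Each turns two solutions into a constant bilinear pairing Ψ(εz+σ)ᵀ X
Φ(z) (`pairing_const`). Entry (i,j) of such a constant, multiplied by an exponential of x²ζ(p ωⁱ +
ωʲ), must have a finite limit on every admissible ray. A vanishing exponent makes the entry readable
from the leading terms; a growing exponential forces it to be 0 (`exists_pairing`).

Inversion leaves no unknown entry (`loop_pairing`), so Ψ₁^(0) is the inverse transpose of the
inverted Ψ₁^(∞). Hence E₁ is a self-pairing of Ψ₁^(∞), and is symmetric. Pairing Ψ₁^(∞) with its own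
rotation by π/3 leaves exactly one free entry, which gives a; call this matrix N. Comparison with
the fully determined pairing of Ψ_{4/3}^(∞) gives Q₁. A half-turn is three rotations by π/3, so N
N⁻ᵀ N gives S₁.

Complex conjugation preserves Ψ₁^(∞) up to a column swap; this makes ωa and A real and makes B and
its conjugate neighbours in E₁. Inversion reverses rotations, whence E N⁻¹ E = ω² N. Thus J = ω² E
N⁻¹ is an involution, and its determinant is -1. The relations adj J = -J and J² = 1 yield all the
remaining relations (`connection_relations`), the linear one being tr J = 1. -/

lemma omega_eq : omega = ⟨-1 / 2, Real.sqrt 3 / 2⟩ := by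
  have h : (2 * Real.pi * Complex.I / 3 : ℂ) = ((Real.pi - Real.pi / 3 : ℝ) : ℂ) * Complex.I := by
    push_cast; ring
  rw [omega, h]
  apply Complex.ext
  · rw [Complex.exp_ofReal_mul_I_re, Real.cos_pi_sub, Real.cos_pi_div_three]; norm_num
  · rw [Complex.exp_ofReal_mul_I_im, Real.sin_pi_sub, Real.sin_pi_div_three]

lemma omega_re : omega.re = -1 / 2 := by rw [omega_eq]

lemma omega_im : omega.im = Real.sqrt 3 / 2 := by rw [omega_eq]

lemma omega_sq : omega ^ 2 = -1 - omega := by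
  have h : Real.sqrt 3 * Real.sqrt 3 = 3 := Real.mul_self_sqrt (by norm_num)
  apply Complex.ext
  · simp only [pow_two, Complex.mul_re, Complex.sub_re, Complex.neg_re, Complex.one_re,
      omega_re, omega_im]
    linarith
  · simp only [pow_two, Complex.mul_im, Complex.sub_im, Complex.neg_im, Complex.one_im,
      omega_re, omega_im]
    linarith

lemma omega_cube : omega ^ 3 = 1 := by
  linear_combination (omega - 1) * omega_sq

lemma omega_ne_zero : omega ≠ 0 := Complex.exp_ne_zero _

lemma conj_omega : conj omega = omega ^ 2 := by
  rw [omega_sq]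
  apply Complex.ext
  · simp only [Complex.conj_re, Complex.sub_re, Complex.neg_re, Complex.one_re, omega_re]
    norm_num
  · simp only [Complex.conj_im, Complex.sub_im, Complex.neg_im, Complex.one_im, omega_im]
    norm_num

lemma exp_pi_third : Complex.exp (Real.pi * Complex.I / 3) = -omega ^ 2 := by
  have h : (Real.pi * Complex.I / 3 : ℂ) = ((Real.pi / 3 : ℝ) : ℂ) * Complex.I := by
    push_cast; ring
  rw [h, omega_sq]
  apply Complex.ext
  · rw [Complex.exp_ofReal_mul_I_re, Real.cos_pi_div_three]
    simp only [Complex.sub_re, Complex.neg_re, Complex.one_re, omega_re]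
    norm_num
  · rw [Complex.exp_ofReal_mul_I_im, Real.sin_pi_div_three]
    simp only [Complex.sub_im, Complex.neg_im, Complex.one_im, omega_im]
    norm_num

lemma Omega_inv : Omega⁻¹ = (1 / 3 : ℂ) • !![1, 1, 1;
     1, omega ^ 2, omega;
     1, omega, omega ^ 2] := by
  apply Matrix.inv_eq_right_inv
  have h2 := omega_sq
  have h3 := omega_cube
  ext i j
  fin_cases i <;> fin_cases j <;> simp [Omega, Matrix.mul_apply, Fin.sum_univ_three] <;> grind

/-! ### Bilinear pairings of solutions -/

lemma hasDerivAt_matrix_mul {F G : ℂ → Mat3} {F' G' : Mat3} {z : ℂ}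
    (hF : ∀ i j, HasDerivAt (fun y => F y i j) (F' i j) z)
    (hG : ∀ i j, HasDerivAt (fun y => G y i j) (G' i j) z) (i j : Fin 3) :
    HasDerivAt (fun y => (F y * G y) i j) ((F' * G z + F z * G') i j) z := by
  simp only [Matrix.mul_apply, Matrix.add_apply, ← Finset.sum_add_distrib]
  exact HasDerivAt.fun_sum fun k _ => (hF i k).mul (hG k j)

/-- If `X` intertwines `A(exp z)` with the negative transpose of the coefficient matrix pulled back
by `z ↦ ε z + σ`, it defines a constant pairing of any two solutions. -/
theorem pairing_const {w : ℝ → ℝ} {x : ℝ} {Ψ Φ : ℂ → Mat3}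
    (hΨ : IsSolution w x Ψ) (hΦ : IsSolution w x Φ) (ε σ : ℂ) (X : Mat3)
    (h : ∀ z, (ε * Complex.exp (ε * z + σ)) • ((coeff w x (Complex.exp (ε * z + σ)))ᵀ * X)
      + Complex.exp z • (X * coeff w x (Complex.exp z)) = 0) (z z' : ℂ) :
    (Ψ (ε * z + σ))ᵀ * X * Φ z = (Ψ (ε * z' + σ))ᵀ * X * Φ z' := by
  have hd : ∀ (y : ℂ) (i j : Fin 3),
      HasDerivAt (fun y => ((Ψ (ε * y + σ))ᵀ * X * Φ y) i j) 0 y := by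
    intro y i j
    have h1 : ∀ i j, HasDerivAt (fun y => (Ψ (ε * y + σ))ᵀ i j)
        (((ε * Complex.exp (ε * y + σ)) • (coeff w x (Complex.exp (ε * y + σ))
          * Ψ (ε * y + σ))ᵀ) i j) y := by
      intro i j
      have hl : HasDerivAt (fun y : ℂ => ε * y + σ) ε y := by
        simpa using ((hasDerivAt_id y).const_mul ε).add_const σ
      have := (hΨ (ε * y + σ) j i).comp y hl
      refine this.congr_deriv ?_
      simp only [Matrix.smul_apply, Matrix.transpose_apply, smul_eq_mul]
      ring
    have h2 : ∀ i j, HasDerivAt (fun y => Φ y i j)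
        ((Complex.exp y • (coeff w x (Complex.exp y) * Φ y)) i j) y := fun i j => hΦ y i j
    have h3 : ∀ i j, HasDerivAt (fun _ : ℂ => X i j) ((0 : Mat3) i j) y :=
      fun i j => hasDerivAt_const _ _
    have h4 := hasDerivAt_matrix_mul (hasDerivAt_matrix_mul h1 h3) h2 i j
    refine h4.congr_deriv ?_
    have e : ((ε * Complex.exp (ε * y + σ)) • (coeff w x (Complex.exp (ε * y + σ))
          * Ψ (ε * y + σ))ᵀ * X + (Ψ (ε * y + σ))ᵀ * 0) * Φ y
        + (Ψ (ε * y + σ))ᵀ * X * (Complex.exp y • (coeff w x (Complex.exp y) * Φ y))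
        = (Ψ (ε * y + σ))ᵀ *
          ((ε * Complex.exp (ε * y + σ)) • ((coeff w x (Complex.exp (ε * y + σ)))ᵀ * X)
          + Complex.exp y • (X * coeff w x (Complex.exp y))) * Φ y := by
      simp only [Matrix.transpose_mul, mul_zero, add_zero, Matrix.mul_add, Matrix.add_mul,
        Matrix.smul_mul, Matrix.mul_smul, Matrix.mul_assoc]
    rw [e, h y]
    simp
  ext i j
  exact is_const_of_deriv_eq_zero (fun y => (hd y i j).differentiableAt)
    (fun y => (hd y i j).deriv) z z'

/-! ### The three symmetries of the coefficient matrix. -/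

/-- The matrix with ones on the antidiagonal. -/
def antiDiag : Mat3 := !![0, 0, 1; 0, 1, 0; 1, 0, 0]

/-- The product of the antidiagonal matrix with `d₃⁻¹ = d₃²`. -/
def twist : Mat3 := !![0, 0, omega; 0, omega ^ 2, 0; 1, 0, 0]

lemma coeff_eq (w : ℝ → ℝ) (x : ℝ) (ζ : ℂ) : coeff w x ζ =
    !![-(x / ζ * deriv w x), -(1 / ζ ^ 2 * Real.exp (-w x)), -(x ^ 2 * Real.exp (2 * w x));
       -(x ^ 2 * Real.exp (-w x)), 0, -(1 / ζ ^ 2 * Real.exp (-w x));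
       -(1 / ζ ^ 2 * Real.exp (2 * w x)), -(x ^ 2 * Real.exp (-w x)), x / ζ * deriv w x] := by
  ext i j
  fin_cases i <;> fin_cases j <;> simp [coeff, W, diagW]

/-- Reflection in the antidiagonal fixes W and negates w_x, while ζ ↦ -ζ changes the signs of the
other two terms of ζA(ζ). -/
lemma antiDiag_intertwines (w : ℝ → ℝ) (x : ℝ) (z : ℂ) :
    ((1 : ℂ) * Complex.exp (1 * z + Real.pi * Complex.I)) •
        ((coeff w x (Complex.exp (1 * z + Real.pi * Complex.I)))ᵀ * antiDiag)
      + Complex.exp z • (antiDiag * coeff w x (Complex.exp z)) = 0 := by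
  have hz := Complex.exp_ne_zero z
  rw [one_mul, one_mul, Complex.exp_add, Complex.exp_pi_mul_I]
  generalize Complex.exp z = ζ at *
  ext i j
  fin_cases i <;> fin_cases j <;>
    simp [coeff_eq, antiDiag, Matrix.mul_apply, Fin.sum_univ_three] <;> field_simp <;>
    try ring

lemma twist_intertwines (w : ℝ → ℝ) (x : ℝ) (z : ℂ) :
    ((1 : ℂ) * Complex.exp (1 * z + Real.pi * Complex.I / 3)) •
        ((coeff w x (Complex.exp (1 * z + Real.pi * Complex.I / 3)))ᵀ * twist)
      + Complex.exp z • (twist * coeff w x (Complex.exp z)) = 0 := by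
  have hz := Complex.exp_ne_zero z
  have ho := omega_ne_zero
  have h3 := omega_cube
  rw [one_mul, one_mul, Complex.exp_add, exp_pi_third]
  generalize Complex.exp z = ζ at *
  ext i j
  fin_cases i <;> fin_cases j <;>
    simp [coeff_eq, twist, Matrix.mul_apply, Fin.sum_univ_three] <;> field_simp <;> grind

/-- The inversion exchanges the W and Wᵀ terms of ζA(ζ), and transposition exchanges them back; the
sign comes from dz ↦ -dz. -/
lemma one_intertwines (w : ℝ → ℝ) {x : ℝ} (hx : 0 < x) (z : ℂ) :
    ((-1 : ℂ) * Complex.exp (-1 * z + (-2 * Real.log x : ℝ))) •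
        ((coeff w x (Complex.exp (-1 * z + (-2 * Real.log x : ℝ))))ᵀ * 1)
      + Complex.exp z • (1 * coeff w x (Complex.exp z)) = 0 := by
  have hz := Complex.exp_ne_zero z
  have hx' : (x : ℂ) ≠ 0 := by exact_mod_cast hx.ne'
  have h : Complex.exp (-1 * z + (-2 * Real.log x : ℝ)) = (x ^ 2 * Complex.exp z)⁻¹ := by
    rw [Complex.exp_add, ← Complex.ofReal_exp, show -2 * Real.log x = -(Real.log x + Real.log x) by
      ring, Real.exp_neg, Real.exp_add, Real.exp_log hx, neg_one_mul, Complex.exp_neg]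
    push_cast
    field_simp
  rw [h]
  generalize Complex.exp z = ζ at *
  ext i j
  fin_cases i <;> fin_cases j <;>
    simp [coeff_eq] <;> field_simp <;> try ring

open Filter Topology Asymptotics

/-! ### Leading asymptotics along rays -/

/-- `Ψ exp (x² ζ d₃)` tends to `P_∞` along the rays with arguments in `S`. -/
def HasLimitInf (u x : ℝ) (S : Set ℝ) (Ψ : ℂ → Mat3) : Prop :=
  ∀ θ ∈ S, Tendsto (fun r : ℝ => Ψ (r + θ * Complex.I)
    * expD3 ((x : ℂ) ^ 2 * Complex.exp (r + θ * Complex.I))) atTop (𝓝 (Pinf u))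

/-- `Ψ exp (-d₃ / ζ)` tends to `P₀` along the rays, with arguments in `S`, going into `0`. -/
def HasLimitZero (u : ℝ) (S : Set ℝ) (Ψ : ℂ → Mat3) : Prop :=
  ∀ θ ∈ S, Tendsto (fun r : ℝ => Ψ (-r + θ * Complex.I)
    * expD3 (-(1 / Complex.exp (-r + θ * Complex.I)))) atTop (𝓝 (P0 u))

lemma tendsto_of_isBigO_sub {l : Filter ℂ} {g : ℝ → ℂ} (hg : Tendsto g atTop l)
    {F : ℂ → Mat3} {P : Mat3} {f : ℂ → ℂ}
    (h : ∀ i j, (fun z => (F z - P) i j) =O[l] f)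
    (hf : Tendsto (fun r => f (g r)) atTop (𝓝 0)) :
    Tendsto (fun r => F (g r)) atTop (𝓝 P) := by
  refine tendsto_pi_nhds.2 fun i => tendsto_pi_nhds.2 fun j => ?_
  have h1 := ((h i j).comp_tendsto hg).trans_tendsto hf
  simpa [Function.comp_def] using h1.add_const (P i j)

lemma IsCanonicalInf.hasLimitInf {w : ℝ → ℝ} {x : ℝ} {n : ℚ} {Ψ : ℂ → Mat3}
    (h : IsCanonicalInf w x n Ψ) : HasLimitInf (w x) x (argRangeInf n) Ψ := by
  obtain ⟨-, m, ⟨-, hm0, -⟩, hO⟩ := h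
  intro θ hθ
  have hO' := hO 1 θ θ (by simpa using hθ)
  refine tendsto_of_isBigO_sub (g := fun r : ℝ => (r : ℂ) + θ * Complex.I)
    (F := fun z => Ψ z * expD3 ((x : ℂ) ^ 2 * Complex.exp z))
    (l := comap Complex.re atTop ⊓ 𝓟 {z | z.im ∈ Set.Icc θ θ}) ?_
    (fun i j => by simpa [hm0] using hO' i j) ?_
  · refine tendsto_inf.2 ⟨tendsto_comap_iff.2 ?_, tendsto_principal.2 (by simp)⟩
    have h1 : Tendsto (fun r : ℝ => r) atTop atTop := tendsto_id
    simpa [Function.comp_def] using h1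
  · refine tendsto_zero_iff_norm_tendsto_zero.2 ?_
    simpa [Complex.norm_exp, Real.exp_neg] using Real.tendsto_exp_neg_atTop_nhds_zero

lemma IsCanonicalZero.hasLimitZero {w : ℝ → ℝ} {x : ℝ} {n : ℚ} {Ψ : ℂ → Mat3}
    (h : IsCanonicalZero w x n Ψ) : HasLimitZero (w x) (argRangeZero n) Ψ := by
  obtain ⟨-, m, ⟨-, hm0, -⟩, hO⟩ := h
  intro θ hθ
  have hO' := hO 1 θ θ (by simpa using hθ)
  refine tendsto_of_isBigO_sub (g := fun r : ℝ => -(r : ℂ) + θ * Complex.I)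
    (F := fun z => Ψ z * expD3 (-(1 / Complex.exp z)))
    (l := comap Complex.re atBot ⊓ 𝓟 {z | z.im ∈ Set.Icc θ θ}) ?_
    (fun i j => by simpa [hm0] using hO' i j) ?_
  · refine tendsto_inf.2 ⟨tendsto_comap_iff.2 ?_, tendsto_principal.2 (by simp)⟩
    simpa [Function.comp_def] using tendsto_neg_atTop_atBot
  · refine tendsto_zero_iff_norm_tendsto_zero.2 ?_
    simpa [Complex.norm_exp] using Real.tendsto_exp_neg_atTop_nhds_zero

lemma expD3_eq (c : ℂ) :
    expD3 c = Matrix.diagonal fun i : Fin 3 => Complex.exp (c * omega ^ (i : ℕ)) := by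
  rw [expD3]
  congr 1
  ext i
  fin_cases i <;> simp

/-- A nonzero m would make the norm grow like the exponential of a positive multiple of `Real.exp
r`. -/
lemma eq_zero_of_tendsto_exp_mul {x : ℝ} (hx : 0 < x) {θ : ℝ} {v m l : ℂ}
    (hv : 0 < (Complex.exp (θ * Complex.I) * v).re)
    (h : Tendsto (fun r : ℝ => Complex.exp ((x : ℂ) ^ 2 * Complex.exp (r + θ * Complex.I) * v) * m)
      atTop (𝓝 l)) : m = 0 := by
  by_contra hm
  have h1 : ∀ r : ℝ, ‖Complex.exp ((x : ℂ) ^ 2 * Complex.exp (r + θ * Complex.I) * v) * m‖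
      = Real.exp (x ^ 2 * (Complex.exp (θ * Complex.I) * v).re * Real.exp r) * ‖m‖ := by
    intro r
    rw [norm_mul, Complex.norm_exp, Complex.exp_add, ← Complex.ofReal_exp, ← Complex.ofReal_pow,
      show ((x ^ 2 : ℝ) : ℂ) * ((Real.exp r : ℂ) * Complex.exp (θ * Complex.I)) * v
        = ((x ^ 2 * Real.exp r : ℝ) : ℂ) * (Complex.exp (θ * Complex.I) * v) by push_cast; ring,
      Complex.re_ofReal_mul]
    ring_nf
  have h2 := h.norm
  simp only [h1] at h2
  refine not_tendsto_nhds_of_tendsto_atTop ?_ _ h2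
  refine Tendsto.atTop_mul_const (norm_pos_iff.2 hm) (Real.tendsto_exp_atTop.comp ?_)
  exact Tendsto.const_mul_atTop (by positivity) Real.tendsto_exp_atTop

/-- The constant matrix of a pairing is determined, up to the entries which are exponentially
small on all the rays, by the leading asymptotics of the two solutions. -/
theorem exists_pairing {w : ℝ → ℝ} {x : ℝ} (hx : 0 < x) {Ψ Φ : ℂ → Mat3}
    (hΨ : IsSolution w x Ψ) (hΦ : IsSolution w x Φ) (ε σ : ℂ) (X : Mat3)
    (h : ∀ z, (ε * Complex.exp (ε * z + σ)) • ((coeff w x (Complex.exp (ε * z + σ)))ᵀ * X)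
      + Complex.exp z • (X * coeff w x (Complex.exp z)) = 0)
    (p : ℂ) {U V : Mat3} {S : Set ℝ}
    (hU : ∀ θ ∈ S, Tendsto (fun r : ℝ => Ψ (ε * (r + θ * Complex.I) + σ)
      * expD3 ((x : ℂ) ^ 2 * Complex.exp (r + θ * Complex.I) * p)) atTop (𝓝 U))
    (hV : ∀ θ ∈ S, Tendsto (fun r : ℝ => Φ (r + θ * Complex.I)
      * expD3 ((x : ℂ) ^ 2 * Complex.exp (r + θ * Complex.I))) atTop (𝓝 V)) :
    ∃ M : Mat3, (∀ z, (Ψ (ε * z + σ))ᵀ * X * Φ z = M) ∧ ∀ i j : Fin 3, ∀ θ ∈ S,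
      (p * omega ^ (i : ℕ) + omega ^ (j : ℕ) = 0 → M i j = (Uᵀ * X * V) i j) ∧
      (0 < (Complex.exp (θ * Complex.I) * (p * omega ^ (i : ℕ) + omega ^ (j : ℕ))).re →
        M i j = 0) := by
  refine ⟨(Ψ (ε * 0 + σ))ᵀ * X * Φ 0, fun z => pairing_const hΨ hΦ ε σ X h z 0,
    fun i j θ hθ => ?_⟩
  have hM := fun z => pairing_const hΨ hΦ ε σ X h z 0
  generalize (Ψ (ε * 0 + σ))ᵀ * X * Φ 0 = M at hM ⊢
  -- The two diagonal exponentials act on the rows and columns of the constant matrix, so in entry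
  -- (i,j) their exponents add.
  have hlim : Tendsto (fun r : ℝ => Complex.exp ((x : ℂ) ^ 2 * Complex.exp (r + θ * Complex.I)
      * (p * omega ^ (i : ℕ) + omega ^ (j : ℕ))) * M i j) atTop (𝓝 ((Uᵀ * X * V) i j)) := by
    have hc : Continuous fun q : Mat3 × Mat3 => (q.1ᵀ * X * q.2) i j := by fun_prop
    have h1 := (hc.tendsto (U, V)).comp ((hU θ hθ).prodMk_nhds (hV θ hθ))
    refine h1.congr fun r => ?_
    have h2 := hM (r + θ * Complex.I)
    simp only [Function.comp_apply]
    rw [Matrix.transpose_mul, show ∀ A B C D E : Mat3, A * B * C * (D * E) = A * (B * C * D) * E by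
      intros; simp only [mul_assoc], h2, expD3_eq, expD3_eq, Matrix.diagonal_transpose,
      Matrix.mul_diagonal, Matrix.diagonal_mul, mul_right_comm, ← Complex.exp_add]
    congr 2
    ring
  refine ⟨fun h0 => ?_, fun hpos => eq_zero_of_tendsto_exp_mul hx hpos hlim⟩
  simp only [h0, mul_zero, Complex.exp_zero, one_mul] at hlim
  exact tendsto_nhds_unique tendsto_const_nhds hlim

/-! ### Leading coefficients of the three pairings; w₀ cancels from each. -/

lemma P0_transpose_mul_Pinf (u : ℝ) : (P0 u)ᵀ * 1 * Pinf u = 1 := by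
  have h2 := omega_sq
  have h3 := omega_cube
  have he : Complex.exp u * Complex.exp (-u) = 1 := by rw [← Complex.exp_add]; simp
  rw [Pinf, P0, Omega_inv]
  ext i j
  fin_cases i <;> fin_cases j <;>
    simp [Omega, Matrix.mul_apply, Fin.sum_univ_three, Matrix.diagonal_apply] <;> grind

lemma Pinf_transpose_mul_antiDiag_mul_Pinf (u : ℝ) :
    (Pinf u)ᵀ * antiDiag * Pinf u = (1 / 3 : ℂ) • !![1, 0, 0; 0, omega, 0; 0, 0, omega ^ 2] := by
  have h2 := omega_sq
  have h3 := omega_cube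
  have he : Complex.exp u * Complex.exp (-u) = 1 := by rw [← Complex.exp_add]; simp
  rw [Pinf, Omega_inv]
  ext i j
  fin_cases i <;> fin_cases j <;>
    simp [antiDiag, Matrix.mul_apply, Fin.sum_univ_three, Matrix.diagonal_apply] <;> grind

lemma Pinf_transpose_mul_twist_mul_Pinf (u : ℝ) :
    (Pinf u)ᵀ * twist * Pinf u = (1 / 3 : ℂ) • !![0, 0, 1; omega, 0, 0; 0, omega ^ 2, 0] := by
  have h2 := omega_sq
  have h3 := omega_cube
  have he : Complex.exp u * Complex.exp (-u) = 1 := by rw [← Complex.exp_add]; simp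
  rw [Pinf, Omega_inv]
  ext i j
  fin_cases i <;> fin_cases j <;>
    simp [twist, Matrix.mul_apply, Fin.sum_univ_three, Matrix.diagonal_apply] <;> grind

lemma exp_neg_pi_div_two : Complex.exp ((-(Real.pi / 2) : ℝ) * Complex.I) = -Complex.I := by
  apply Complex.ext <;>
    simp only [Complex.exp_ofReal_mul_I_re, Complex.exp_ofReal_mul_I_im, Real.cos_neg, Real.sin_neg]
    <;> simp

lemma exp_pi_div_two : Complex.exp ((Real.pi / 2 : ℝ) * Complex.I) = Complex.I := by
  apply Complex.ext <;>
    simp only [Complex.exp_ofReal_mul_I_re, Complex.exp_ofReal_mul_I_im] <;> simp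
/-! ### The pairings of the canonical solutions -/

/-- On the rays ±π/2 the growth rate of exponent v is ∓Im v, so every non-real v grows on one of the
two and kills its entry. -/
lemma eq_of_forced {M L : Mat3} {p : ℂ} {S : Set ℝ} (h1 : Real.pi / 2 ∈ S)
    (h2 : -(Real.pi / 2) ∈ S)
    (h : ∀ i j : Fin 3, ∀ θ ∈ S,
      (p * omega ^ (i : ℕ) + omega ^ (j : ℕ) = 0 → M i j = L i j) ∧
      (0 < (Complex.exp (θ * Complex.I) * (p * omega ^ (i : ℕ) + omega ^ (j : ℕ))).re →
        M i j = 0))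
    (hL : ∀ i j : Fin 3, p * omega ^ (i : ℕ) + omega ^ (j : ℕ) = 0 ∨
      (p * omega ^ (i : ℕ) + omega ^ (j : ℕ)).im ≠ 0 ∧ L i j = 0) : M = L := by
  ext i j
  have hij := h i j
  rcases hL i j with h0 | ⟨him, h0⟩
  · exact (hij _ h1).1 h0
  · rw [h0]
    generalize p * omega ^ (i : ℕ) + omega ^ (j : ℕ) = v at him hij
    rcases him.lt_or_gt with hlt | hgt
    · refine (hij _ h1).2 ?_
      rw [exp_pi_div_two]
      simpa using hlt
    · refine (hij _ h2).2 ?_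
      rw [exp_neg_pi_div_two]
      simpa using hgt

lemma exponent_neg_one (i j : Fin 3) :
    (-1) * omega ^ (i : ℕ) + omega ^ (j : ℕ) = 0 ∨
      ((-1) * omega ^ (i : ℕ) + omega ^ (j : ℕ)).im ≠ 0 ∧ i ≠ j := by
  fin_cases i <;> fin_cases j <;> simp [omega_sq, omega_im]
  ring

lemma exponent_neg_omega_sq (i j : Fin 3) :
    (-omega ^ 2) * omega ^ (i : ℕ) + omega ^ (j : ℕ) = 0 ∨
      ((-omega ^ 2) * omega ^ (i : ℕ) + omega ^ (j : ℕ)).im ≠ 0 ∧ i ≠ j + 1 := by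
  have h3 : (-1 - omega) * omega = 1 := by linear_combination -omega_sq
  have h4 : (-1 - omega) * (-1 - omega) = omega := by linear_combination omega_sq
  fin_cases i <;> fin_cases j <;> simp [omega_sq, omega_im, omega_re] <;> grind

/-- The rays with arguments `±π/2`. -/
def verticalRays : Set ℝ := {Real.pi / 2, -(Real.pi / 2)}

lemma argRange_bounds {θ : ℝ} (hθ : θ ∈ verticalRays) :
    θ ∈ argRangeInf 1 ∧ -θ ∈ argRangeZero 1 ∧ θ + Real.pi / 3 ∈ argRangeInf (4 / 3) ∧
      θ + Real.pi ∈ argRangeInf 2 := by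
  have hpi := Real.pi_pos
  rcases hθ with rfl | rfl <;> simp only [argRangeInf, argRangeZero, Set.mem_Ioo, Set.mem_ofPred_eq]
    <;> norm_num <;> refine ⟨?_, ?_, ?_⟩ <;> (try constructor) <;> linarith

/-- Eliminates the solution at 0 in favour of the one at infinity. It also gives invertibility, and
it characterises Ψ uniquely, which the reality argument uses. -/
theorem loop_pairing {w : ℝ → ℝ} {x : ℝ} (hx : 0 < x) {Ψ₀ Ψ : ℂ → Mat3}
    (h₀ : IsSolution w x Ψ₀) (h : IsSolution w x Ψ) (hl₀ : HasLimitZero (w x) (argRangeZero 1) Ψ₀)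
    (hl : HasLimitInf (w x) x (argRangeInf 1) Ψ) (z : ℂ) :
    (Ψ₀ (-1 * z + (-2 * Real.log x : ℝ)))ᵀ * Ψ z = 1 := by
  obtain ⟨M, hM, hM'⟩ := exists_pairing hx h₀ h (-1) (-2 * Real.log x : ℝ) 1 (one_intertwines w hx)
    (-1) (S := verticalRays) (U := P0 (w x)) (V := Pinf (w x)) (fun θ hθ => by
      have h1 := (hl₀ (-θ) (argRange_bounds hθ).2.1).comp
        (tendsto_atTop_add_const_right atTop (2 * Real.log x) tendsto_id)
      refine h1.congr fun r => ?_
      have e1 : (-((r + 2 * Real.log x : ℝ) : ℂ) + ((-θ : ℝ) : ℂ) * Complex.I)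
          = -1 * (r + θ * Complex.I) + (-2 * Real.log x : ℝ) := by push_cast; ring
      have e2 : -(1 / Complex.exp (-1 * (r + θ * Complex.I) + (-2 * Real.log x : ℝ)))
          = (x : ℂ) ^ 2 * Complex.exp (r + θ * Complex.I) * (-1) := by
        rw [one_div, ← Complex.exp_neg, show -(-1 * ((r : ℂ) + θ * Complex.I) + (-2 * Real.log x : ℝ))
          = Real.log x + Real.log x + (r + θ * Complex.I) by push_cast; ring,
          Complex.exp_add, Complex.exp_add, ← Complex.ofReal_exp, Real.exp_log hx]
        ring
      simp only [Function.comp_apply, id]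
      rw [e1, e2])
    (fun θ hθ => hl θ (argRange_bounds hθ).1)
  rw [P0_transpose_mul_Pinf] at hM'
  have := eq_of_forced (by simp [verticalRays]) (by simp [verticalRays]) hM' fun i j =>
    (exponent_neg_one i j).imp id fun h => ⟨h.1, by simp [h.2]⟩
  rw [← this, ← hM z, mul_one]

lemma tendsto_shift {x u : ℝ} {S : Set ℝ} {Ψ : ℂ → Mat3} (hl : HasLimitInf u x S Ψ)
    {θ δ : ℝ} {p : ℂ} (hθ : θ + δ ∈ S) (hp : Complex.exp (δ * Complex.I) = p) :
    Tendsto (fun r : ℝ => Ψ (1 * (r + θ * Complex.I) + δ * Complex.I)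
      * expD3 ((x : ℂ) ^ 2 * Complex.exp (r + θ * Complex.I) * p)) atTop (𝓝 (Pinf u)) := by
  refine (hl _ hθ).congr fun r => ?_
  have e1 : (r : ℂ) + ((θ + δ : ℝ) : ℂ) * Complex.I = r + θ * Complex.I + δ * Complex.I := by
    push_cast; ring
  rw [e1, Complex.exp_add (r + θ * Complex.I), hp, one_mul, mul_assoc]

theorem antiDiag_pairing {w : ℝ → ℝ} {x : ℝ} (hx : 0 < x) {Ψ₂ Ψ : ℂ → Mat3}
    (h₂ : IsSolution w x Ψ₂) (h : IsSolution w x Ψ) (hl₂ : HasLimitInf (w x) x (argRangeInf 2) Ψ₂)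
    (hl : HasLimitInf (w x) x (argRangeInf 1) Ψ) (z : ℂ) :
    (Ψ₂ (z + Real.pi * Complex.I))ᵀ * antiDiag * Ψ z
      = (1 / 3 : ℂ) • !![1, 0, 0; 0, omega, 0; 0, 0, omega ^ 2] := by
  obtain ⟨M, hM, hM'⟩ := exists_pairing hx h₂ h 1 (Real.pi * Complex.I) antiDiag
    (antiDiag_intertwines w x) (-1) (S := verticalRays) (U := Pinf (w x)) (V := Pinf (w x))
    (fun θ hθ => tendsto_shift hl₂ (argRange_bounds hθ).2.2.2 Complex.exp_pi_mul_I)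
    (fun θ hθ => hl θ (argRange_bounds hθ).1)
  rw [Pinf_transpose_mul_antiDiag_mul_Pinf] at hM'
  have := eq_of_forced (by simp [verticalRays]) (by simp [verticalRays]) hM' fun i j =>
    (exponent_neg_one i j).imp id fun h => ⟨h.1, by
      have := h.2
      fin_cases i <;> fin_cases j <;> simp at this ⊢⟩
  rw [← this, ← hM z, one_mul]

lemma exp_pi_third' : Complex.exp ((Real.pi / 3 : ℝ) * Complex.I) = -omega ^ 2 := by
  rw [← exp_pi_third]
  push_cast
  ring_nf

theorem twist_pairing {w : ℝ → ℝ} {x : ℝ} (hx : 0 < x) {Ψ' Ψ : ℂ → Mat3}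
    (h' : IsSolution w x Ψ') (h : IsSolution w x Ψ)
    (hl' : HasLimitInf (w x) x (argRangeInf (4 / 3)) Ψ')
    (hl : HasLimitInf (w x) x (argRangeInf 1) Ψ) (z : ℂ) :
    (Ψ' (z + (Real.pi / 3 : ℝ) * Complex.I))ᵀ * twist * Ψ z
      = (1 / 3 : ℂ) • !![0, 0, 1; omega, 0, 0; 0, omega ^ 2, 0] := by
  obtain ⟨M, hM, hM'⟩ := exists_pairing hx h' h 1 ((Real.pi / 3 : ℝ) * Complex.I) twist
    (fun z => by
      convert twist_intertwines w x z using 6 <;> push_cast <;> ring_nf)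
    (-omega ^ 2) (S := verticalRays) (U := Pinf (w x)) (V := Pinf (w x))
    (fun θ hθ => tendsto_shift hl' (argRange_bounds hθ).2.2.1 exp_pi_third')
    (fun θ hθ => hl θ (argRange_bounds hθ).1)
  rw [Pinf_transpose_mul_twist_mul_Pinf] at hM'
  have := eq_of_forced (by simp [verticalRays]) (by simp [verticalRays]) hM' fun i j =>
    (exponent_neg_omega_sq i j).imp id fun h => ⟨h.1, by
      have := h.2
      fin_cases i <;> fin_cases j <;> simp at this ⊢⟩
  rw [← this, ← hM z, one_mul]

/-- Both points must lie in Ω₁^(∞), so only rays with -2π/3 < θ < π/3 are available. On all of them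
the exponential of entry (1,2) decays, so this entry alone stays free: it is the Stokes parameter.
-/
theorem exists_twist_self_pairing {w : ℝ → ℝ} {x : ℝ} (hx : 0 < x) {Ψ : ℂ → Mat3}
    (h : IsSolution w x Ψ) (hl : HasLimitInf (w x) x (argRangeInf 1) Ψ) :
    ∃ a : ℂ, ∀ z, (Ψ (z + (Real.pi / 3 : ℝ) * Complex.I))ᵀ * twist * Ψ z
      = (1 / 3 : ℂ) • !![0, 0, 1; omega, 0, -a; 0, omega ^ 2, 0] := by
  have hpi := Real.pi_pos
  -- The ray -π/2 kills entries (0,0), (0,1), (1,1); the ray 0 kills (2,0); the ray π/6 kills (2,2),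
  -- whose exponent is -i√3.
  have hb : ∀ θ ∈ ({-(Real.pi / 2), 0, Real.pi / 6} : Set ℝ),
      θ ∈ argRangeInf 1 ∧ θ + Real.pi / 3 ∈ argRangeInf 1 := by
    intro θ hθ
    rcases hθ with rfl | rfl | rfl <;> simp only [argRangeInf, Set.mem_Ioo]
      <;> norm_num <;> (try constructor) <;> (try constructor) <;> linarith
  obtain ⟨M, hM, hM'⟩ := exists_pairing hx h h 1 ((Real.pi / 3 : ℝ) * Complex.I) twist
    (fun z => by
      convert twist_intertwines w x z using 6 <;> push_cast <;> ring_nf)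
    (-omega ^ 2) (S := {-(Real.pi / 2), 0, Real.pi / 6}) (U := Pinf (w x)) (V := Pinf (w x))
    (fun θ hθ => tendsto_shift hl (hb θ hθ).2 exp_pi_third')
    (fun θ hθ => hl θ (hb θ hθ).1)
  rw [Pinf_transpose_mul_twist_mul_Pinf] at hM'
  refine ⟨-3 * M 1 2, fun z => ?_⟩
  have hz := hM z
  rw [one_mul] at hz
  rw [hz]
  have h2 := omega_sq
  have h3 := omega_cube
  have down : ∀ i j : Fin 3, 0 < (-omega ^ 2 * omega ^ (i : ℕ) + omega ^ (j : ℕ)).im →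
      M i j = 0 := fun i j hij => (hM' i j (-(Real.pi / 2)) (by simp)).2 (by
    rw [exp_neg_pi_div_two]
    simpa using hij)
  have right : ∀ i j : Fin 3, 0 < (-omega ^ 2 * omega ^ (i : ℕ) + omega ^ (j : ℕ)).re →
      M i j = 0 := fun i j hij => (hM' i j 0 (by simp)).2 (by simpa using hij)
  have zero : ∀ i j : Fin 3, -omega ^ 2 * omega ^ (i : ℕ) + omega ^ (j : ℕ) = 0 →
      M i j = ((1 / 3 : ℂ) • !![0, 0, 1; omega, 0, 0; 0, omega ^ 2, 0] : Mat3) i j :=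
    fun i j hij => (hM' i j 0 (by simp)).1 hij
  have h4 : omega ^ 2 * omega = 1 := by rw [← h3]; ring
  have h5 : omega ^ 2 * omega ^ 2 = omega := by linear_combination omega * h3
  ext i j
  fin_cases i <;> fin_cases j
  · simpa using down 0 0 (by simp [h2, omega_im])
  · simpa using down 0 1 (by simp [h2, omega_im])
  · simpa using zero 0 2 (by simp)
  · simpa using zero 1 0 (by simp [h4])
  · simpa using down 1 1 (by simp [h4, omega_im])
  · simp
  · simpa using right 2 0 (by simp [h5, omega_re]; norm_num)
  · simpa using zero 2 1 (by simp [h5])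
  · have : M 2 2 = 0 := (hM' 2 2 (Real.pi / 6) (by simp)).2 (by
      have e : (-omega ^ 2 * omega ^ ((2 : Fin 3) : ℕ) + omega ^ ((2 : Fin 3) : ℕ))
          = ⟨0, -Real.sqrt 3⟩ := by
        simp only [Fin.val_two, neg_mul, h5]
        rw [h2, omega_eq]
        apply Complex.ext <;> simp <;> ring
      rw [e, Complex.mul_re, Complex.exp_ofReal_mul_I_re, Complex.exp_ofReal_mul_I_im,
        Real.sin_pi_div_six]
      simp)
    simpa using this
/-! ### The Stokes matrices -/

/-- The matrix of the pairing of `Ψ₁^(∞)` with its rotation by `π / 3`. -/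
def twistMatrix (a : ℂ) : Mat3 := (1 / 3 : ℂ) • !![0, 0, 1; omega, 0, -a; 0, omega ^ 2, 0]

/-- The inverse of `twistMatrix a`. -/
def twistMatrixInv (a : ℂ) : Mat3 :=
  (3 : ℂ) • !![omega ^ 2 * a, omega ^ 2, 0; 0, 0, omega; 1, 0, 0]

lemma twistMatrix_mul_inv (a : ℂ) : twistMatrix a * twistMatrixInv a = 1 := by
  have h3 := omega_cube
  ext i j
  fin_cases i <;> fin_cases j <;>
    simp [twistMatrix, twistMatrixInv, Matrix.mul_apply, Fin.sum_univ_three] <;> grind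

lemma mul_left_injective_of_isUnit {P Q R : Mat3} (hR : IsUnit R) (h : P * R = Q * R) : P = Q :=
  hR.mul_left_injective h

lemma twist_mul_twist : (omega ^ 2 • twist) * twist = 1 := by
  have h3 := omega_cube
  ext i j
  fin_cases i <;> fin_cases j <;>
    simp [twist, Matrix.mul_apply, Fin.sum_univ_three] <;> grind

lemma isUnit_twist : IsUnit twist :=
  IsUnit.of_mul_eq_one_right _ twist_mul_twist

lemma isUnit_antiDiag : IsUnit antiDiag := by
  refine IsUnit.of_mul_eq_one_right antiDiag ?_
  ext i j
  fin_cases i <;> fin_cases j <;> simp [antiDiag, Matrix.mul_apply, Fin.sum_univ_three]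

/-- The jump across a single Stokes ray. -/
theorem jump_eq {Ψ Ψ' : ℂ → Mat3} {a c : ℂ} (hu : ∀ z, IsUnit (Ψ z))
    (h : ∀ z, (Ψ (z + c))ᵀ * twist * Ψ z = twistMatrix a)
    (h' : ∀ z, (Ψ' (z + c))ᵀ * twist * Ψ z = twistMatrix 0) (z : ℂ) :
    Ψ' z = Ψ z * !![1, a, 0; 0, 1, 0; 0, 0, 1] := by
  have h1 := h (z - c)
  have h2 := h' (z - c)
  rw [sub_add_cancel, mul_assoc] at h1
  rw [sub_add_cancel] at h2
  have h3 : twistMatrix 0 = !![1, a, 0; 0, 1, 0; 0, 0, 1]ᵀ * twistMatrix a := by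
    ext i j
    fin_cases i <;> fin_cases j <;>
      simp [twistMatrix, Matrix.mul_apply, Fin.sum_univ_three]
    ring
  rw [h3, ← h1, mul_assoc, ← mul_assoc _ (Ψ z)ᵀ, ← Matrix.transpose_mul] at h2
  exact Matrix.transpose_injective
    (mul_left_injective_of_isUnit (isUnit_twist.mul (hu _)) h2)

/-- Inverts a pairing: PXR = N gives R N⁻¹ P = X⁻¹. This removes the solutions at intermediate
points from a chain of pairings. -/
lemma sandwich_eq {P R X Y N K : Mat3} (h : P * X * R = N) (hK : N * K = 1) (hX : Y * X = 1) :
    R * K * P = Y := by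
  have h1 : X * (R * K * P) = 1 := by
    have : P * (X * R * K) = 1 := by rw [← hK, ← h]; simp only [mul_assoc]
    rw [← mul_eq_one_comm.1 this]; simp only [mul_assoc]
  calc R * K * P = Y * X * (R * K * P) := by rw [hX, one_mul]
    _ = Y := by rw [mul_assoc, h1, mul_one]

/-- The inverse of the transpose of `twist`. -/
def coTwist : Mat3 := !![0, 0, omega ^ 2; 0, omega, 0; 1, 0, 0]

lemma coTwist_mul_twist_transpose : coTwist * twistᵀ = 1 := by
  have h3 := omega_cube
  ext i j
  fin_cases i <;> fin_cases j <;>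
    simp [twist, coTwist, Matrix.mul_apply, Fin.sum_univ_three] <;> grind

lemma twist_mul_coTwist_mul_twist : twist * coTwist * twist = omega ^ 2 • antiDiag := by
  have h3 := omega_cube
  ext i j
  fin_cases i <;> fin_cases j <;>
    simp [twist, coTwist, antiDiag, Matrix.mul_apply, Fin.sum_univ_three] <;> grind

/-- Compares the half-turn self-pairing of Ψ₁^(∞), composed from three rotations by π/3, with its
half-turn pairing against Ψ₂^(∞). -/
lemma twistMatrix_braid (a : ℂ) : !![1, a, 0; 0, 1, 0; a, -a * omega ^ 2, 1]ᵀ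
      * (omega • (twistMatrix a * (twistMatrixInv a)ᵀ * twistMatrix a))
      = (1 / 3 : ℂ) • !![1, 0, 0; 0, omega, 0; 0, 0, omega ^ 2] := by
  have h3 := omega_cube
  have e : (twistMatrixInv a)ᵀ = (3 : ℂ) • !![omega ^ 2 * a, 0, 1; omega ^ 2, 0, 0; 0, omega, 0] := by
    ext i j
    fin_cases i <;> fin_cases j <;> simp [twistMatrixInv]
  rw [e]
  ext i j
  fin_cases i <;> fin_cases j <;>
    simp [twistMatrix, Matrix.mul_apply, Fin.sum_univ_three] <;> grind

/-- The Stokes matrix of the half-turn. -/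
theorem stokes_eq {Ψ Ψ₂ : ℂ → Mat3} {a c : ℂ} (hu : ∀ z, IsUnit (Ψ z))
    (h : ∀ z, (Ψ (z + c))ᵀ * twist * Ψ z = twistMatrix a)
    (h₂ : ∀ z, (Ψ₂ (z + 3 * c))ᵀ * antiDiag * Ψ z
      = (1 / 3 : ℂ) • !![1, 0, 0; 0, omega, 0; 0, 0, omega ^ 2]) (z : ℂ) :
    Ψ₂ z = Ψ z * !![1, a, 0; 0, 1, 0; a, -a * omega ^ 2, 1] := by
  have hω3 := omega_cube
  have e0 := h (z - c)
  have e1 := h (z - 2 * c)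
  have e2 := h (z - 3 * c)
  have e3 := h₂ (z - 3 * c)
  rw [sub_add_cancel] at e0 e3
  rw [show z - 2 * c + c = z - c by ring] at e1
  rw [show z - 3 * c + c = z - 2 * c by ring] at e2
  have e1' : (Ψ (z - 2 * c))ᵀ * twistᵀ * Ψ (z - c) = (twistMatrix a)ᵀ := by
    rw [← e1]; simp only [Matrix.transpose_mul, Matrix.transpose_transpose, mul_assoc]
  have hK : (twistMatrix a)ᵀ * (twistMatrixInv a)ᵀ = 1 := by
    rw [← Matrix.transpose_mul, mul_eq_one_comm.1 (twistMatrix_mul_inv a), Matrix.transpose_one]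
  -- The middle of the three pairings enters transposed and inverted, so that it joins the solutions
  -- at z - c and z - 2c.
  have h5 := sandwich_eq e1' hK coTwist_mul_twist_transpose
  have h6 : twistMatrix a * (twistMatrixInv a)ᵀ * twistMatrix a
      = omega ^ 2 • ((Ψ z)ᵀ * (antiDiag * Ψ (z - 3 * c))) := by
    calc twistMatrix a * (twistMatrixInv a)ᵀ * twistMatrix a
        = ((Ψ z)ᵀ * twist * Ψ (z - c)) * (twistMatrixInv a)ᵀ
          * ((Ψ (z - 2 * c))ᵀ * twist * Ψ (z - 3 * c)) := by rw [e0, e2]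
      _ = (Ψ z)ᵀ * (twist * (Ψ (z - c) * (twistMatrixInv a)ᵀ * (Ψ (z - 2 * c))ᵀ) * twist)
          * Ψ (z - 3 * c) := by simp only [mul_assoc]
      _ = _ := by
        rw [h5, twist_mul_coTwist_mul_twist]
        simp only [Matrix.smul_mul, Matrix.mul_smul, mul_assoc]
  have h7 : !![1, a, 0; 0, 1, 0; a, -a * omega ^ 2, 1]ᵀ
      * (omega • (twistMatrix a * (twistMatrixInv a)ᵀ * twistMatrix a))
      = (1 / 3 : ℂ) • !![1, 0, 0; 0, omega, 0; 0, 0, omega ^ 2] := twistMatrix_braid a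
  rw [h6, smul_smul, show omega * omega ^ 2 = 1 by rw [← hω3]; ring, one_smul, ← e3,
    ← mul_assoc, mul_assoc (Ψ₂ z)ᵀ, ← Matrix.transpose_mul] at h7
  exact (Matrix.transpose_injective
    (mul_left_injective_of_isUnit (isUnit_antiDiag.mul (hu _)) h7)).symm

/-! ### Reality -/

/-- The permutation matrix exchanging the last two basis vectors. -/
def swap : Mat3 := !![1, 0, 0; 0, 0, 1; 0, 1, 0]

lemma swap_mul_swap : swap * swap = 1 := by
  ext i j
  fin_cases i <;> fin_cases j <;> simp [swap, Matrix.mul_apply, Fin.sum_univ_three]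

lemma swap_transpose : swapᵀ = swap := by
  ext i j
  fin_cases i <;> fin_cases j <;> simp [swap]

lemma coeff_conj (w : ℝ → ℝ) (x : ℝ) (ζ : ℂ) :
    (coeff w x (conj ζ)).map conj = coeff w x ζ := by
  ext i j
  fin_cases i <;> fin_cases j <;>
    simp [coeff_eq, ← Complex.exp_conj, Complex.conj_ofReal, Complex.conj_ofNat]

lemma IsSolution.conj_conj {w : ℝ → ℝ} {x : ℝ} {Ψ : ℂ → Mat3} (h : IsSolution w x Ψ) (C : Mat3) :
    IsSolution w x fun z => (Ψ (conj z)).map conj * C := by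
  intro z i j
  have h1 : ∀ i j, HasDerivAt (fun y => (Ψ (conj y)).map conj i j)
      ((Complex.exp z • (coeff w x (Complex.exp z) * (Ψ (conj z)).map conj)) i j) z := by
    intro i j
    have h2 := (h (conj z) i j).conj_conj
    rw [Complex.conj_conj] at h2
    refine h2.congr_deriv ?_
    have h3 := coeff_conj w x (Complex.exp z)
    rw [map_mul, ← Complex.exp_conj, Complex.conj_conj, Matrix.smul_apply, smul_eq_mul, ← h3,
      ← Matrix.map_mul, Matrix.map_apply, Complex.exp_conj]
  have h3 : ∀ i j, HasDerivAt (fun _ : ℂ => C i j) ((0 : Mat3) i j) z :=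
    fun i j => hasDerivAt_const _ _
  refine (hasDerivAt_matrix_mul h1 h3 i j).congr_deriv ?_
  rw [mul_zero, add_zero, Matrix.smul_mul, mul_assoc, Matrix.smul_apply, smul_eq_mul]

lemma Pinf_conj (u : ℝ) : (Pinf u).map conj * swap = Pinf u := by
  have h := conj_omega
  have h3 := omega_cube
  have h4 : (omega ^ 2) ^ 2 = omega := by linear_combination omega * h3
  rw [Pinf, Omega_inv]
  ext i j
  fin_cases i <;> fin_cases j <;>
    simp [swap, Matrix.mul_apply, Fin.sum_univ_three, Matrix.diagonal_apply, h, h4,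
      ← Complex.exp_conj, Complex.conj_ofReal, Complex.conj_ofNat]

lemma expD3_conj (c : ℂ) : swap * expD3 c = (expD3 (conj c)).map conj * swap := by
  have h := conj_omega
  have h3 := omega_cube
  have h4 : (omega ^ 2) ^ 2 = omega := by linear_combination omega * h3
  ext i j
  fin_cases i <;> fin_cases j <;>
    simp [swap, expD3, Matrix.mul_apply, Matrix.diagonal_apply, h, h4,
      ← Complex.exp_conj]

lemma HasLimitInf.conj_conj {u x : ℝ} {S : Set ℝ} (hS : ∀ θ ∈ S, -θ ∈ S) {Ψ : ℂ → Mat3}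
    (h : HasLimitInf u x S Ψ) : HasLimitInf u x S fun z => (Ψ (conj z)).map conj * swap := by
  intro θ hθ
  have hc : Continuous fun M : Mat3 => M.map conj * swap :=
    (continuous_id.matrix_map Complex.continuous_conj).mul continuous_const
  have h1 := (hc.tendsto _).comp (h (-θ) (hS θ hθ))
  rw [Pinf_conj] at h1
  refine h1.congr fun r => ?_
  have e : (r : ℂ) + ((-θ : ℝ) : ℂ) * Complex.I = conj ((r : ℂ) + θ * Complex.I) := by
    simp
  have e2 : (x : ℂ) ^ 2 * Complex.exp (conj ((r : ℂ) + θ * Complex.I))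
      = conj ((x : ℂ) ^ 2 * Complex.exp ((r : ℂ) + θ * Complex.I)) := by
    rw [map_mul, map_pow, Complex.conj_ofReal, Complex.exp_conj]
  simp only [Function.comp_apply]
  rw [e, e2, Matrix.map_mul, mul_assoc, mul_assoc, ← expD3_conj]

/-! ### The determinant -/

/-- The coefficient matrix is traceless, so the determinant is constant; the exponential factor has
determinant 1 because 1 + ω + ω² = 0. -/
theorem det_eq {w : ℝ → ℝ} {x : ℝ} {S : Set ℝ} (hS : S.Nonempty) {Ψ : ℂ → Mat3}
    (h : IsSolution w x Ψ) (hl : HasLimitInf (w x) x S Ψ) (z : ℂ) :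
    (Ψ z).det = (Pinf (w x)).det := by
  have hd : ∀ y, HasDerivAt (fun y => (Ψ y).det) 0 y := by
    intro y
    simp only [Matrix.det_fin_three]
    have H := h y
    have := ((((((((H 0 0).mul (H 1 1)).mul (H 2 2)).sub (((H 0 0).mul (H 1 2)).mul (H 2 1))).sub
      (((H 0 1).mul (H 1 0)).mul (H 2 2))).add (((H 0 1).mul (H 1 2)).mul (H 2 0))).add
      (((H 0 2).mul (H 1 0)).mul (H 2 1))).sub (((H 0 2).mul (H 1 1)).mul (H 2 0)))
    refine this.congr_deriv ?_
    simp only [Pi.mul_apply, coeff_eq, Matrix.mul_apply, Fin.sum_univ_three, Matrix.of_apply,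
      Matrix.cons_val', Matrix.cons_val]
    ring
  have hc : ∀ z z', (Ψ z).det = (Ψ z').det := is_const_of_deriv_eq_zero
    (fun y => (hd y).differentiableAt) (fun y => (hd y).deriv)
  have he : ∀ c, (expD3 c).det = 1 := by
    intro c
    rw [expD3, Matrix.det_diagonal]
    simp only [Fin.prod_univ_three, Matrix.cons_val]
    rw [← Complex.exp_add, ← Complex.exp_add, omega_sq]
    ring_nf
    exact Complex.exp_zero
  obtain ⟨θ, hθ⟩ := hS
  have hcd : Continuous fun M : Mat3 => M.det := Continuous.matrix_det continuous_id
  have h1 := (hcd.tendsto _).comp (hl θ hθ)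
  refine tendsto_nhds_unique (tendsto_const_nhds.congr fun r => ?_) h1
  rw [Function.comp_apply, Matrix.det_mul, he, mul_one]
  exact hc _ _

lemma det_Pinf_sq (u : ℝ) : (Pinf u).det * (Pinf u).det = -1 / 27 := by
  have h2 := omega_sq
  have he : Complex.exp u * Complex.exp (-u) = 1 := by rw [← Complex.exp_add]; simp
  rw [Pinf, Omega_inv, Matrix.det_mul, Matrix.det_diagonal, Matrix.det_smul]
  simp [Fin.prod_univ_three, Matrix.det_fin_three, he]
  grind
/-! ### The connection matrix -/

lemma det_twistMatrixInv (a : ℂ) : (twistMatrixInv a).det = 27 := by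
  have h3 := omega_cube
  rw [twistMatrixInv, Matrix.det_smul, Matrix.det_fin_three]
  simp
  grind

lemma smul_mul_twistMatrixInv {a A B B' D A' D' : ℂ} {s : ℝ} (ha : a = omega ^ 2 * s) :
    omega ^ 2 • (!![A, B, B'; B, D, A'; B', A', D'] * twistMatrixInv a)
      = !![3 * (s * A + omega ^ 2 * B'), 3 * (omega * A), 3 * B;
           3 * (s * B + omega ^ 2 * A'), 3 * (omega * B), 3 * D;
           3 * (s * B' + omega ^ 2 * D'), 3 * (omega * B'), 3 * A'] := by
  have h3 := omega_cube
  ext i j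
  fin_cases i <;> fin_cases j <;>
    simp [twistMatrixInv, ha] <;> grind

lemma adjugate_eq_neg {J : Mat3} (h : J * J = 1) (hd : J.det = -1) : J.adjugate = -J := by
  calc J.adjugate = J.adjugate * J * J := by rw [mul_assoc, h, mul_one]
    _ = -J := by rw [Matrix.adjugate_mul, hd]; simp

/-- The algebraic relations among the entries of a symmetric connection matrix. -/
theorem connection_relations {a A B B' D A' D' : ℂ} {s : ℝ} (ha : a = omega ^ 2 * s)
    (hB : B = 0 ↔ B' = 0)
    (hq : !![A, B, B'; B, D, A'; B', A', D'] * twistMatrixInv a *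
      !![A, B, B'; B, D, A'; B', A', D'] = omega ^ 2 • twistMatrix a)
    (hdet : !![A, B, B'; B, D, A'; B', A', D'].det = -1 / 27) :
    A' = A ∧ A ^ 2 - 1 / 3 * A = B * B' ∧ (1 + s) * A + omega * B + omega ^ 2 * B' = 1 / 3 ∧
      D = omega * s * A - omega ^ 2 * s * B + B' ∧
      D' = omega ^ 2 * s * A + B - omega * s * B' := by
  have hω := omega_sq
  have h3 := omega_cube
  have hω0 := omega_ne_zero
  have hJ := smul_mul_twistMatrixInv (A := A) (B := B) (B' := B') (D := D) (A' := A') (D' := D') ha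
  -- With J = ω² E N⁻¹, the quadratic relation becomes J² = 1.
  have hsq : (omega ^ 2 • (!![A, B, B'; B, D, A'; B', A', D'] * twistMatrixInv a))
      * (omega ^ 2 • (!![A, B, B'; B, D, A'; B', A', D'] * twistMatrixInv a)) = 1 := by
    rw [Matrix.smul_mul, Matrix.mul_smul, ← mul_assoc, hq, Matrix.smul_mul, twistMatrix_mul_inv,
      smul_smul, smul_smul, show omega ^ 2 * omega ^ 2 * omega ^ 2 = 1 by grind, one_smul]
  have hdJ : (omega ^ 2 • (!![A, B, B'; B, D, A'; B', A', D'] * twistMatrixInv a)).det = -1 := by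
    rw [Matrix.det_smul, Matrix.det_mul, det_twistMatrixInv, hdet, Fintype.card_fin,
      show (omega ^ 2) ^ 3 = 1 by grind]
    norm_num
  have hadj := adjugate_eq_neg hsq hdJ
  rw [hJ] at hsq hadj
  rw [Matrix.adjugate_fin_three] at hadj
  have e01 := congrFun (congrFun hadj 0) 1
  have e02 := congrFun (congrFun hadj 0) 2
  have e21 := congrFun (congrFun hadj 2) 1
  have e22 := congrFun (congrFun hadj 2) 2
  have f01 := congrFun (congrFun hsq 0) 1
  have hd0 := hdet
  rw [Matrix.det_fin_three] at hd0
  simp [Matrix.mul_apply, Fin.sum_univ_three] at e01 e02 e21 e22 f01 hd0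
  clear hq hdet hJ hsq hdJ hadj
  have k1 : A * A' - B * B' = A / 3 := by
    have : omega * (A * A' - B * B' - A / 3) = 0 := by linear_combination -(1 / 9) * e01
    have := (mul_eq_zero.1 this).resolve_left hω0
    linear_combination this
  have k2 : A' = A := by
    linear_combination 3 * k1 + (1 / 3) * e22 + 3 * (A * A' - B * B') * h3
  subst k2
  -- If A vanished, then so would BB', hence both B and B', and with them the first row of E,
  -- against det E = -1/27.
  have hA : A' ≠ 0 := by
    rintro rfl
    have hBB : B * B' = 0 := by linear_combination -k1
    rcases mul_eq_zero.1 hBB with h | h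
    · have h' := hB.1 h
      norm_num [h, h'] at hd0
    · have h' := hB.2 h
      norm_num [h, h'] at hd0
  -- This is tr J = 1: by Cayley–Hamilton, adj J - J² + (tr J) J is scalar, so its (0,1) entry gives
  -- (tr J - 1) J₀₁ = 0, and J₀₁ = 3ωA is nonzero.
  have k3 : (1 + s) * A' + omega * B + omega ^ 2 * B' = 1 / 3 := by
    have : omega * A' * ((1 + s) * A' + omega * B + omega ^ 2 * B' - 1 / 3) = 0 := by
      linear_combination (1 / 9) * f01 - (1 / 9) * e01
    have := (mul_eq_zero.1 this).resolve_left (mul_ne_zero hω0 hA)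
    linear_combination this
  refine ⟨rfl, by linear_combination k1, k3, ?_, ?_⟩
  · have k4 : A' * D = B ^ 2 - omega ^ 2 * B / 3 := by
      linear_combination (omega ^ 2 / 9) * e02 + (B ^ 2 - A' * D) * h3
    refine mul_left_cancel₀ hA ?_
    linear_combination k4 - (omega * A' - omega ^ 2 * B) * k3 + omega * k1
      + (A' * B' - B ^ 2 - omega * B * B') * h3
  · have k4 : A' * D' = B' ^ 2 - omega * B' / 3 := by
      linear_combination (1 / 9) * e21 + (B' ^ 2 - A' * D') * h3
    refine mul_left_cancel₀ hA ?_
    linear_combination k4 - (omega ^ 2 * A' - omega * B') * k3 + omega ^ 2 * k1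
      + (omega * A' * B' + A' * B - B' ^ 2) * h3

lemma swap_mul_mul_swap_entries (M : Mat3) : (swap * M * swap) 0 0 = M 0 0 ∧
    (swap * M * swap) 0 1 = M 0 2 ∧ (swap * M * swap) 1 2 = M 2 1 := by
  simp [swap, Matrix.mul_apply, Matrix.vecMul, dotProduct, Fin.sum_univ_three]

end RadialToda

end

/-! ### Assembly of the pairings into the theorem. -/

open RadialToda in
theorem mainTheorem5 (w₀ : ℝ → ℝ) (hw : RadialToda.IsRadialTodaSolution w₀)
    (x : ℝ) (hx : 0 < x)
    -- the canonical solutions at infinity with indices 1, 4/3, 2 and at zero with index 1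
    (Ψinf₁ Ψinf₄₃ Ψinf₂ Ψzero₁ : ℂ → RadialToda.Mat3)
    (hinf₁ : RadialToda.IsCanonicalInf w₀ x 1 Ψinf₁)
    (hinf₄₃ : RadialToda.IsCanonicalInf w₀ x (4 / 3) Ψinf₄₃)
    (hinf₂ : RadialToda.IsCanonicalInf w₀ x 2 Ψinf₂)
    (hzero₁ : RadialToda.IsCanonicalZero w₀ x 1 Ψzero₁) :
    ∃ (E₁ Q₁ S₁ : RadialToda.Mat3) (A s : ℝ) (a B : ℂ),
      -- the connection matrix, the jump matrix and the Stokes matrix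
      RadialToda.IsTransitionMatrix Ψzero₁ Ψinf₁ E₁ ∧
      RadialToda.IsTransitionMatrix Ψinf₁ Ψinf₄₃ Q₁ ∧
      RadialToda.IsTransitionMatrix Ψinf₁ Ψinf₂ S₁ ∧
      -- the Stokes parameter
      Q₁ = !![1, a, 0;
              0, 1, 0;
              0, 0, 1] ∧
      S₁ = !![1, a, 0;
              0, 1, 0;
              a, -a * RadialToda.omega ^ 2, 1] ∧
      a = RadialToda.omega ^ 2 * (s : ℂ) ∧
      -- the parametrization of the connection matrix
      E₁ = !![(A : ℂ), B, conj B;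
              B, RadialToda.omega * s * A - RadialToda.omega ^ 2 * s * B + conj B, (A : ℂ);
              conj B, (A : ℂ), RadialToda.omega ^ 2 * s * A + B - RadialToda.omega * s * conj B] ∧
      A ^ 2 - 1 / 3 * A = ‖B‖ ^ 2 ∧
      (1 + (s : ℂ)) * A + RadialToda.omega * B + RadialToda.omega ^ 2 * conj B = 1 / 3 := by
  have hl₁ := hinf₁.hasLimitInf
  have hl₀ := hzero₁.hasLimitZero
  have loop := loop_pairing hx hzero₁.1 hinf₁.1 hl₀ hl₁
  obtain ⟨κ, hκ⟩ : ∃ κ : ℝ, κ = -2 * Real.log x := ⟨_, rfl⟩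
  obtain ⟨c, hc⟩ : ∃ c : ℂ, c = (Real.pi / 3 : ℝ) * Complex.I := ⟨_, rfl⟩
  have hcc : conj c = -c := by rw [hc]; simp [Complex.conj_ofNat]
  obtain ⟨a, ha⟩ := exists_twist_self_pairing hx hinf₁.1 hl₁
  have jump := twist_pairing hx hinf₄₃.1 hinf₁.1 hinf₄₃.hasLimitInf hl₁
  have half := antiDiag_pairing hx hinf₂.1 hinf₁.1 hinf₂.hasLimitInf hl₁
  have conn := pairing_const hinf₁.1 hinf₁.1 (-1) (-2 * Real.log x : ℝ) 1 (one_intertwines w₀ hx)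
  rw [← hκ] at conn loop
  rw [← hc] at ha jump
  change ∀ z, _ = twistMatrix a at ha
  have hu : ∀ z, IsUnit (Ψinf₁ z) := fun z => IsUnit.of_mul_eq_one_right _ (loop z)
  have hinv : ∀ z, -1 * (-1 * z + (κ : ℂ)) + κ = z := fun z => by ring
  have hu₀ : ∀ z, IsUnit (Ψzero₁ z) := fun z => by
    have h1 := loop (-1 * z + κ)
    rw [hinv] at h1
    have h2 : IsUnit (Ψzero₁ z)ᵀ := IsUnit.of_mul_eq_one _ h1
    exact (Matrix.isUnit_transpose _).1 h2
  obtain ⟨E, hE⟩ : ∃ E, ∀ z, (Ψinf₁ (-1 * z + κ))ᵀ * Ψinf₁ z = E :=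
    ⟨_, fun z => by have := conn z 0; rwa [mul_one, mul_one] at this⟩
  -- Inversion is an involution: evaluating the constant pairing at the inverted point transposes
  -- it.
  have hsym : Eᵀ = E := by
    have h1 := hE (-1 * 0 + κ)
    rw [hinv] at h1
    rw [← hE 0, Matrix.transpose_mul, Matrix.transpose_transpose, h1, hE 0]
  have hE₀ : ∀ z, Ψinf₁ z = Ψzero₁ z * E := by
    intro z
    have h1 := loop (-1 * z + κ)
    rw [hinv] at h1
    have h2 : Ψzero₁ z * (Ψinf₁ (-1 * z + κ))ᵀ = 1 := by
      rw [← Matrix.transpose_one, ← mul_eq_one_comm.1 h1, Matrix.transpose_mul,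
        Matrix.transpose_transpose]
    rw [← hE z, ← mul_assoc, h2, one_mul]
  -- Both sides are solutions with the same leading limits in a sector symmetric under conjugation,
  -- so both have pairing 1 with Ψ₁^(0).
  have hreal : ∀ z, (Ψinf₁ (conj z)).map conj * swap = Ψinf₁ z := by
    intro z
    have h1 := loop_pairing hx hzero₁.1 (hinf₁.1.conj_conj swap) hl₀
      (hl₁.conj_conj fun θ hθ => by
        simp only [argRangeInf, Set.mem_Ioo] at hθ ⊢
        norm_num at hθ ⊢
        constructor <;> linarith) z
    rw [← hκ, ← loop z] at h1
    have h2 : IsUnit (Ψzero₁ (-1 * z + κ))ᵀ := (Matrix.isUnit_transpose _).2 (hu₀ _)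
    exact h2.mul_right_injective h1
  have hreal' : ∀ z, (Ψinf₁ (conj z)).map conj = Ψinf₁ z * swap := fun z => by
    rw [← hreal z, mul_assoc, swap_mul_swap, mul_one]
  have hconj : E.map conj = swap * E * swap := by
    have h1 := hreal' (-1 * 0 + κ)
    have h2 := hreal' 0
    rw [map_zero] at h2
    rw [show conj (-1 * 0 + (κ : ℂ)) = -1 * 0 + κ by simp] at h1
    rw [← hE 0, Matrix.map_mul, Matrix.transpose_map, h1, h2, Matrix.transpose_mul,
      swap_transpose]
    simp only [mul_assoc]
  have hNconj : (twistMatrix a).map conj = omega ^ 2 • (swap * (twistMatrix a)ᵀ * swap) := by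
    -- Since c is purely imaginary, conjugation exchanges the two points -c/2 and c/2 of this
    -- pairing.
    have h0 := ha (-c / 2)
    rw [show -c / 2 + c = c / 2 by ring] at h0
    have h1 := hreal' (-c / 2)
    have h2 := hreal' (c / 2)
    have e1 : conj (c / 2) = -c / 2 := by rw [map_div₀, hcc, Complex.conj_ofNat]
    have e2 : conj (-c / 2) = c / 2 := by rw [map_div₀, map_neg, hcc, Complex.conj_ofNat, neg_neg]
    rw [e1] at h2
    rw [e2] at h1
    have ht : twist.map conj = omega ^ 2 • twistᵀ := by
      have h3 := omega_cube
      ext i j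
      fin_cases i <;> fin_cases j <;> simp [twist, conj_omega] <;> grind
    rw [← h0, Matrix.map_mul, Matrix.map_mul, Matrix.transpose_map, h1, h2, ht]
    simp only [Matrix.transpose_mul, Matrix.transpose_transpose, swap_transpose, mul_assoc,
      Matrix.smul_mul, Matrix.mul_smul]
  have hquad : E * twistMatrixInv a * E = omega ^ 2 • twistMatrix a := by
    -- The inversion z ↦ κ - z sends the pair 0, c to κ, κ - c. Two copies of E carry the rotation
    -- pairing of the first pair to that of the second, with its direction reversed.
    have h1 := ha (-1 * c + κ)
    have h2 := hE 0
    have h3 := hE c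
    have h4 := ha 0
    rw [zero_add] at h4
    rw [show -1 * c + κ + c = -1 * 0 + κ by ring] at h1
    have h5 : (Ψinf₁ c)ᵀ * Ψinf₁ (-1 * c + κ) = E := by
      rw [← hsym, ← h3, Matrix.transpose_mul, Matrix.transpose_transpose]
    have h6 := sandwich_eq h4 (twistMatrix_mul_inv a) twist_mul_twist
    calc E * twistMatrixInv a * E
        = ((Ψinf₁ (-1 * 0 + κ))ᵀ * Ψinf₁ 0) * twistMatrixInv a
          * ((Ψinf₁ c)ᵀ * Ψinf₁ (-1 * c + κ)) := by rw [h2, h5]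
      _ = (Ψinf₁ (-1 * 0 + κ))ᵀ * (Ψinf₁ 0 * twistMatrixInv a * (Ψinf₁ c)ᵀ)
          * Ψinf₁ (-1 * c + κ) := by simp only [mul_assoc]
      _ = _ := by rw [h6, ← h1, Matrix.mul_smul, Matrix.smul_mul]
  have hdet : E.det = -1 / 27 := by
    have hne : (argRangeInf 1).Nonempty := ⟨Real.pi / 2, (argRange_bounds (by
      simp [verticalRays])).1⟩
    rw [← hE 0, Matrix.det_mul, Matrix.det_transpose, det_eq hne hinf₁.1 hl₁,
      det_eq hne hinf₁.1 hl₁, det_Pinf_sq]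
  have h3 := omega_cube
  -- Entry (1,2) of the conjugation relation says that the conjugate of a is ω²a.
  have hs : conj (omega * a) = omega * a := by
    have e12 := congrFun (congrFun hNconj 1) 2
    rw [Matrix.smul_apply, (swap_mul_mul_swap_entries _).2.2] at e12
    simp [twistMatrix, Complex.conj_ofNat] at e12
    rw [map_mul, conj_omega]
    linear_combination (3 * omega ^ 2) * e12 + omega * a * h3
  obtain ⟨s, hs⟩ := Complex.conj_eq_iff_real.1 hs
  have has : a = omega ^ 2 * s := by rw [← hs]; linear_combination -a * h3
  obtain ⟨m00, m01, -⟩ := swap_mul_mul_swap_entries E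
  have c00 := (congrFun (congrFun hconj 0) 0).trans m00
  have c01 := (congrFun (congrFun hconj 0) 1).trans m01
  rw [Matrix.map_apply] at c00 c01
  obtain ⟨A, hA⟩ := Complex.conj_eq_iff_real.1 c00
  have s10 : E 1 0 = E 0 1 := congrFun (congrFun hsym 0) 1
  have s20 : E 2 0 = E 0 2 := congrFun (congrFun hsym 0) 2
  have s21 : E 2 1 = E 1 2 := congrFun (congrFun hsym 1) 2
  have hEform : E = !![(A : ℂ), E 0 1, conj (E 0 1); E 0 1, E 1 1, E 1 2;
      conj (E 0 1), E 1 2, E 2 2] := by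
    ext i j
    fin_cases i <;> fin_cases j <;> simp [hA, s10, s20, s21, c01]
  rw [hEform] at hquad hdet
  obtain ⟨r1, r2, r3, r4, r5⟩ := connection_relations has (by simp) hquad hdet
  refine ⟨E, _, _, A, s, a, E 0 1, ⟨hu₀, hE₀⟩, ⟨hu, jump_eq hu ha fun z => ?_⟩,
    ⟨hu, stokes_eq hu ha fun z => ?_⟩, rfl, rfl, has, ?_, ?_, r3⟩
  · rw [jump z, twistMatrix, neg_zero]
  · rw [← half z, hc]
    push_cast
    ring_nf
  · rw [← r4, ← r5, ← r1]
    conv_lhs => rw [hEform]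
    rw [r1]
  · rw [Complex.mul_conj, Complex.normSq_eq_norm_sq] at r2
    apply Complex.ofReal_injective
    push_cast at r2 ⊢
    exact r2
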